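/- Let $A$ be a commutative noetherian ring. For an ideal $I$ of $A$ and a finitely generated $A$-module $M$ with $IM\neq M$, let $\operatorname{depth}_I(M)$ denote the supremum of the lengths of the $M$-regular sequences whose terms lie in $I$. A finitely generated $A$-module $M\neq 0$ is called almost Cohen–Macaulay if $\operatorname{depth}_P(M)=\operatorname{depth}_{PA_P}(M_P)$ for every prime ideal $P\in\operatorname{Supp}(M)$, and $A$ is called an almost Cohen–Macaulay ring if it is almost Cohen–Macaulay as a module over itself, that is, if $A\neq 0$ and $\operatorname{depth}_P(A)=\operatorname{depth}_{PA_P}(A_P)$ for every prime ideal $P$ of $A$. Let $A$ be a commutative noetherian ring and $n\in\mathbb{N}$ (with $n=0$ allowed). Then $A$ is almost Cohen–Macaulay if and only if the formal power series ring $A[[X_1,\ldots,X_n]]$ is almost Cohen–Macaulay. -/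

import Mathlib

/-- The depth `depth_I(M)` of a module `M` with respect to an ideal `I` (the grade of `I` on `M`):
the supremum of the lengths of the `M`-regular sequences with all terms in `I`. Regularity includes
`M / (r₁, …, rₖ) M ≠ 0`, which is automatic for sequences in `I` when `I M ≠ M`. -/
noncomputable def idealDepth {R : Type*} [CommRing R] (I : Ideal R)
    (M : Type*) [AddCommGroup M] [Module R M] : ℕ∞ :=
  ⨆ (rs : List R) (_ : (∀ r ∈ rs, r ∈ I) ∧ RingTheory.Sequence.IsRegular M rs), (rs.length : ℕ∞)

/-- A nonzero finitely generated module `M` over a (noetherian) ring `A` is almost Cohen-Macaulay if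
`depth_P(M) = depth_{P A_P}(M_P)` for every prime `P` in the support of `M`. -/
structure IsAlmostCohenMacaulayModule (A : Type*) [CommRing A]
    (M : Type*) [AddCommGroup M] [Module A M] : Prop where
  nontrivial : Nontrivial M
  finite : Module.Finite A M
  depth_eq : ∀ P ∈ Module.support A M,
    idealDepth P.asIdeal M =
      idealDepth (IsLocalRing.maximalIdeal (Localization.AtPrime P.asIdeal))
        (LocalizedModule P.asIdeal.primeCompl M)

/-- A (noetherian) ring is almost Cohen-Macaulay if it is an almost Cohen-Macaulay module
over itself. -/
def IsAlmostCohenMacaulayRing (A : Type*) [CommRing A] : Prop :=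
  IsAlmostCohenMacaulayModule A A

open RingTheory.Sequence IsLocalRing CategoryTheory Abelian
open scoped Pointwise

universe u

/-! The key is a local criterion, `isAlmostCohenMacaulayRing_iff_height_le`: a nonzero noetherian
ring `A` is almost Cohen–Macaulay iff `ht P ≤ depth A_P + 1` for every prime `P`. Let `x` be a
regular element and `B = A/(x)`. At a prime containing `x`, height and local depth both drop by one
on passing to `B`, so the inequality holds there iff it holds at the corresponding prime of `B`.

If moreover `x` lies in the Jacobson radical, primes `P` avoiding `x` are controlled too. Some prime
`Q` is minimal over `P + (x)`, and `depth A_Q ≤ depth A_P + 1` by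
`localDepth_le_localDepth_add_one`. Hence `ht P + 1 ≤ ht Q ≤ depth A_Q + 1 ≤ depth A_P + 2`. So `A`
and `A/(x)` are almost Cohen–Macaulay together. Applying this to `X` in `A[[X]]` and inducting on
the number of variables gives the theorem. -/

/-! ### Depth and regular sequences -/

theorem isRegular_of_mem_of_isWeaklyRegular {R M : Type*} [CommRing R] [AddCommGroup M]
    [Module R M] {I : Ideal R} (hI : I • (⊤ : Submodule R M) ≠ ⊤) {rs : List R}
    (hmem : ∀ r ∈ rs, r ∈ I) (hreg : IsWeaklyRegular M rs) : IsRegular M rs :=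
  ⟨hreg, fun h ↦ hI <| top_le_iff.mp <| h.le.trans <|
    Submodule.smul_mono_left (Ideal.span_le.mpr hmem)⟩

/-- Initial segments of a regular sequence are regular, so every natural number below the supremum
is the exact length of some sequence. -/
theorem natCast_le_idealDepth_iff {R M : Type*} [CommRing R] [AddCommGroup M] [Module R M]
    {I : Ideal R} (hI : I • (⊤ : Submodule R M) ≠ ⊤) {n : ℕ} :
    (n : ℕ∞) ≤ idealDepth I M ↔
      ∃ rs : List R, rs.length = n ∧ (∀ r ∈ rs, r ∈ I) ∧ IsRegular M rs := by
  constructor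
  · intro h
    obtain ⟨rs, hmem, hreg, hlen⟩ : ∃ rs : List R, (∀ r ∈ rs, r ∈ I) ∧ IsRegular M rs ∧
        n ≤ rs.length := by
      cases n with
      | zero => exact ⟨[], by simp, isRegular_of_mem_of_isWeaklyRegular hI (by simp) (.nil R M),
          by simp⟩
      | succ n =>
        have h' : (n : ℕ∞) < idealDepth I M :=
          lt_of_lt_of_le (by exact_mod_cast n.lt_succ_self) h
        obtain ⟨rs, hrs⟩ := lt_iSup_iff.mp h'
        obtain ⟨hp, hrs⟩ := lt_iSup_iff.mp hrs
        exact ⟨rs, hp.1, hp.2, by exact_mod_cast hrs⟩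
    have hw : IsWeaklyRegular M (rs.take n ++ rs.drop n) := by
      rw [List.take_append_drop]; exact hreg.1
    exact ⟨rs.take n, by simpa using hlen, fun r hr ↦ hmem r (List.mem_of_mem_take hr),
      isRegular_of_mem_of_isWeaklyRegular hI (fun r hr ↦ hmem r (List.mem_of_mem_take hr))
        ((isWeaklyRegular_append_iff M _ _).mp hw).1⟩
  · rintro ⟨rs, rfl, hmem, hreg⟩
    exact le_iSup₂_of_le rs ⟨hmem, hreg⟩ le_rfl

theorem IsRegular.length_le_idealDepth {R M : Type*} [CommRing R] [AddCommGroup M] [Module R M]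
    {I : Ideal R} {rs : List R} (hreg : IsRegular M rs) (hmem : ∀ r ∈ rs, r ∈ I) :
    (rs.length : ℕ∞) ≤ idealDepth I M :=
  le_iSup₂_of_le rs ⟨hmem, hreg⟩ le_rfl

theorem idealDepth_mono {R M : Type*} [CommRing R] [AddCommGroup M] [Module R M]
    {I J : Ideal R} (h : I ≤ J) : idealDepth I M ≤ idealDepth J M :=
  iSup₂_le fun _ hrs ↦ IsRegular.length_le_idealDepth hrs.2 fun r hr ↦ h (hrs.1 r hr)

/-- Depth is invariant under additive isomorphisms that are semilinear along a surjection. -/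
theorem idealDepth_eq_of_semilinear {R S M N : Type*} [CommRing R] [CommRing S] [AddCommGroup M]
    [AddCommGroup N] [Module R M] [Module S N] {f : R →+* S} (hf : Function.Surjective f)
    (e : M ≃+ N) (he : ∀ (r : R) (m : M), e (r • m) = f r • e m) {I : Ideal R} {J : Ideal S}
    (hIJ : I = J.comap f) : idealDepth I M = idealDepth J N := by
  have key (rs : List R) : IsRegular M rs ↔ IsRegular N (rs.map f) :=
    e.isRegular_congr <| List.forall₂_map_right_iff.mpr <| List.forall₂_same.mpr fun r _ x ↦ he r x
  apply le_antisymm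
  · refine iSup₂_le fun rs hrs ↦ ?_
    rw [← rs.length_map (f := f)]
    refine IsRegular.length_le_idealDepth ((key rs).mp hrs.2) fun s hs ↦ ?_
    obtain ⟨r, hr, rfl⟩ := List.mem_map.mp hs
    have := hrs.1 r hr
    rwa [hIJ] at this
  · refine iSup₂_le fun ss hss ↦ ?_
    obtain ⟨rs, rfl⟩ := List.map_surjective_iff.mpr hf ss
    rw [List.length_map]
    refine IsRegular.length_le_idealDepth ((key rs).mpr hss.2) fun r hr ↦ ?_
    rw [hIJ]
    exact hss.1 _ (List.mem_map_of_mem hr)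

theorem LinearEquiv.idealDepth_eq {R M N : Type*} [CommRing R] [AddCommGroup M]
    [AddCommGroup N] [Module R M] [Module R N] (e : M ≃ₗ[R] N) (I : Ideal R) :
    idealDepth I M = idealDepth I N :=
  idealDepth_eq_of_semilinear (f := RingHom.id R) Function.surjective_id e.toAddEquiv
    (fun r m ↦ e.map_smul r m) rfl

theorem smul_top_quotSMulTop_ne_top {R M : Type*} [CommRing R] [AddCommGroup M]
    [Module R M] {I : Ideal R} {r : R} (hr : r ∈ I) (hI : I • (⊤ : Submodule R M) ≠ ⊤) :
    I • (⊤ : Submodule R (QuotSMulTop r M)) ≠ ⊤ := by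
  by_contra eq
  absurd congrArg (Submodule.comap (Submodule.mkQ _)) eq
  simpa [Submodule.comap_smul_top_of_surjective I _ (Submodule.mkQ_surjective _),
    Submodule.smul_mono_left ((Ideal.span_singleton_le_iff_mem I).mpr hr),
    ← Submodule.ideal_span_singleton_smul] using hI

/-- By Rees, sequences of length `n` exist iff `Ext^i(R/I, M) = 0` for all `i < n`. The long exact
sequence of multiplication by `x` passes this vanishing to `M/xM` with one degree lost, so a long
sequence need not itself start with `x`. -/
theorem idealDepth_eq_quotSMulTop_add_one {R M : Type u} [CommRing R] [IsNoetherianRing R]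
    [AddCommGroup M] [Module R M] [Module.Finite R M] {I : Ideal R}
    (hI : I • (⊤ : Submodule R M) ≠ ⊤) {x : R} (hx : x ∈ I) (hreg : IsSMulRegular M x) :
    idealDepth I M = idealDepth I (QuotSMulTop x M) + 1 := by
  have hI' := smul_top_quotSMulTop_ne_top hx hI
  refine ENat.eq_of_forall_natCast_le_iff fun n ↦ ?_
  cases n with
  | zero => simp
  | succ n =>
    rw [Nat.cast_add_one, ENat.add_le_add_iff_right (by simp), ← Nat.cast_add_one,
      natCast_le_idealDepth_iff hI, natCast_le_idealDepth_iff hI']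
    constructor
    · rintro ⟨rs, hlen, hmem, hrs⟩
      have supp : Module.support R (R ⧸ I) = PrimeSpectrum.zeroLocus I := by
        rw [Module.support_eq_zeroLocus, Ideal.annihilator_quotient]
      have ext := ModuleCat.subsingleton_ext_of_exists_isRegular I (ModuleCat.of R (R ⧸ I))
        supp.subset (ModuleCat.of R M) hI.lt_top rs hmem hrs
      refine ModuleCat.exists_isRegular_of_exists_subsingleton_ext I n
        (ModuleCat.of R (QuotSMulTop x M)) hI'.lt_top (ModuleCat.of R (R ⧸ I)) supp
        fun i hi ↦ ?_
      have zero1 := AddCommGrpCat.isZero_of_iff_subsingleton.mpr (ext i (by omega))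
      have zero2 := AddCommGrpCat.isZero_of_iff_subsingleton.mpr (ext (i + 1) (by omega))
      have hreg' : IsSMulRegular (ModuleCat.of R M) x := hreg
      exact AddCommGrpCat.subsingleton_of_isZero <| ShortComplex.Exact.isZero_of_both_zeros
        ((Ext.covariant_sequence_exact₃' (ModuleCat.of R (R ⧸ I))
          hreg'.smulShortComplex_shortExact) i (i + 1) rfl)
        (zero1.eq_zero_of_src _) (zero2.eq_zero_of_tgt _)
    · rintro ⟨rs, hlen, hmem, hrs⟩
      exact ⟨x :: rs, by simp [hlen], by simpa [hx] using hmem, .cons hreg hrs⟩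

theorem idealDepth_eq_quotient_add_length {R M : Type u} [CommRing R] [IsNoetherianRing R]
    [AddCommGroup M] [Module R M] [Module.Finite R M] {I : Ideal R}
    (hI : I • (⊤ : Submodule R M) ≠ ⊤) {rs : List R} (hmem : ∀ r ∈ rs, r ∈ I)
    (hreg : IsWeaklyRegular M rs) :
    idealDepth I M =
      idealDepth I (M ⧸ (Ideal.ofList rs • ⊤ : Submodule R M)) + rs.length := by
  induction rs generalizing M with
  | nil =>
    have e := Submodule.quotEquivOfEqBot (Ideal.ofList ([] : List R) • ⊤ : Submodule R M)
      (by rw [Ideal.ofList_nil, Submodule.bot_smul])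
    simp [e.idealDepth_eq I]
  | cons x rs ih =>
    rw [isWeaklyRegular_cons_iff] at hreg
    have hx := hmem x (by simp)
    rw [idealDepth_eq_quotSMulTop_add_one hI hx hreg.1,
      ih (smul_top_quotSMulTop_ne_top hx hI) (fun r hr ↦ hmem r (by simp [hr])) hreg.2,
      (Submodule.quotOfListConsSMulTopEquivQuotSMulTopInner M x rs).idealDepth_eq I]
    simp [add_assoc]

theorem idealDepth_eq_zero_of_smul_eq_zero {R M : Type*} [CommRing R] [AddCommGroup M]
    [Module R M] {I : Ideal R} {m : M} (hm : m ≠ 0) (h : ∀ r ∈ I, r • m = 0) :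
    idealDepth I M = 0 := by
  refine nonpos_iff_eq_zero.mp <| iSup₂_le fun rs hrs ↦ ?_
  match rs with
  | [] => simp
  | r :: rs =>
    exact absurd (((isRegular_cons_iff M r rs).mp hrs.2).1.right_eq_zero_of_smul
      (h r (hrs.1 r (by simp)))) hm

/-- `Hom(R/I, M)` vanishes iff `I` contains an `M`-regular element; otherwise the image of `1` under
a nonzero map is the required element. -/
theorem exists_smul_eq_zero_of_forall_not_isSMulRegular {R M : Type*} [CommRing R]
    [IsNoetherianRing R] [AddCommGroup M] [Module R M] [Module.Finite R M] {I : Ideal R}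
    (h : ∀ r ∈ I, ¬ IsSMulRegular M r) : ∃ m : M, m ≠ 0 ∧ ∀ r ∈ I, r • m = 0 := by
  have hs : ¬ Subsingleton ((R ⧸ I) →ₗ[R] M) := by
    rw [IsSMulRegular.subsingleton_linearMap_iff, Ideal.annihilator_quotient]
    rintro ⟨r, hr, hr'⟩
    exact h r hr hr'
  rw [not_subsingleton_iff_nontrivial] at hs
  obtain ⟨f, hf⟩ := exists_ne (0 : (R ⧸ I) →ₗ[R] M)
  refine ⟨f 1, fun h0 ↦ hf ?_, fun r hr ↦ ?_⟩
  · ext; simpa using h0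
  · rw [← map_smul, Algebra.smul_def, mul_one, Ideal.Quotient.algebraMap_eq,
      Ideal.Quotient.eq_zero_iff_mem.mpr hr, map_zero]

theorem exists_isSMulRegular_of_idealDepth_ne_zero {R M : Type*} [CommRing R] [AddCommGroup M]
    [Module R M] {I : Ideal R} (h : idealDepth I M ≠ 0) : ∃ x ∈ I, IsSMulRegular M x := by
  by_contra! hc
  refine h <| nonpos_iff_eq_zero.mp <| iSup₂_le fun rs hrs ↦ ?_
  match rs with
  | [] => simp
  | r :: rs => exact absurd ((isRegular_cons_iff M r rs).mp hrs.2).1 (hc r (hrs.1 r (by simp)))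

/-- A regular sequence of maximal length in `I` leaves a nonzero element annihilated by `I`. -/
theorem exists_smul_eq_zero_of_length_eq_idealDepth {R M : Type*} [CommRing R]
    [IsNoetherianRing R] [AddCommGroup M] [Module R M] [Module.Finite R M] {I : Ideal R}
    (hI : I • (⊤ : Submodule R M) ≠ ⊤) {rs : List R} (hmem : ∀ r ∈ rs, r ∈ I)
    (hreg : IsWeaklyRegular M rs) (hlen : idealDepth I M ≤ rs.length) :
    ∃ m : M ⧸ (Ideal.ofList rs • ⊤ : Submodule R M), m ≠ 0 ∧ ∀ r ∈ I, r • m = 0 := by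
  refine exists_smul_eq_zero_of_forall_not_isSMulRegular fun r hr hr' ↦ ?_
  have hmem' : ∀ s ∈ rs ++ [r], s ∈ I := by
    simpa [or_imp, forall_and, hr] using hmem
  have := (IsRegular.length_le_idealDepth (isRegular_of_mem_of_isWeaklyRegular hI hmem'
    ((isWeaklyRegular_append_iff M rs [r]).mpr
      ⟨hreg, (isWeaklyRegular_singleton_iff _ r).mpr hr'⟩)) hmem').trans hlen
  have : (rs ++ [r]).length ≤ rs.length := by exact_mod_cast this
  simp at this

/-! ### Depth under localization -/

theorem idealDepth_le_idealDepth_localization {A : Type*} [CommRing A] (P : Ideal A) [P.IsPrime]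
    (S : Type*) [CommRing S] [IsLocalRing S] [Algebra A S] [IsLocalization.AtPrime S P] :
    idealDepth P A ≤ idealDepth (maximalIdeal S) S := by
  refine iSup₂_le fun rs hrs ↦ ?_
  rw [← rs.length_map (f := algebraMap A S)]
  refine IsRegular.length_le_idealDepth
    (IsWeaklyRegular.isRegular_of_isLocalization_of_mem S P hrs.2.1 hrs.1) fun s hs ↦ ?_
  obtain ⟨r, hr, rfl⟩ := List.mem_map.mp hs
  exact (IsLocalization.AtPrime.to_map_mem_maximal_iff S P r).mpr (hrs.1 r hr)

theorem maximalIdeal_smul_top_ne_top (R : Type*) [CommRing R] [IsLocalRing R] :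
    maximalIdeal R • (⊤ : Submodule R R) ≠ ⊤ := by
  rw [smul_eq_mul, Ideal.mul_top]
  exact (maximalIdeal.isMaximal R).ne_top

theorem Ideal.IsPrime.smul_top_ne_top {R : Type*} [CommRing R] {P : Ideal R} (hP : P.IsPrime) :
    P • (⊤ : Submodule R R) ≠ ⊤ := by
  rw [smul_eq_mul, Ideal.mul_top]
  exact hP.ne_top

/-- Each term of a regular sequence lowers the dimension by one, and the final quotient is nonzero,
hence of nonnegative dimension. -/
theorem idealDepth_maximalIdeal_le_ringKrullDim (R : Type*) [CommRing R] [IsLocalRing R]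
    [IsNoetherianRing R] : (idealDepth (maximalIdeal R) R : WithBot ℕ∞) ≤ ringKrullDim R := by
  rw [← IsLocalRing.maximalIdeal_height_eq_ringKrullDim, WithBot.coe_le_coe]
  refine iSup₂_le fun rs hrs ↦ ?_
  have h := ringKrullDim_add_length_eq_ringKrullDim_of_isRegular rs hrs.2
  have : Nontrivial (R ⧸ Ideal.ofList rs) := Ideal.Quotient.nontrivial_iff.mpr fun h ↦
    hrs.2.2 (by simp [h])
  have h' : ((rs.length : ℕ∞) : WithBot ℕ∞) ≤ ((maximalIdeal R).height : WithBot ℕ∞) := by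
    rw [IsLocalRing.maximalIdeal_height_eq_ringKrullDim, ← h]
    exact le_add_of_nonneg_left ringKrullDim_nonneg_of_nontrivial
  exact WithBot.coe_le_coe.mp h'

/-- The depth of the localization of a ring at a prime ideal. -/
noncomputable def Ideal.localDepth {A : Type*} [CommRing A] (P : Ideal A) [P.IsPrime] : ℕ∞ :=
  idealDepth (maximalIdeal (Localization.AtPrime P)) (Localization.AtPrime P)

theorem idealDepth_le_localDepth {A : Type*} [CommRing A] (P : Ideal A) [P.IsPrime] :
    idealDepth P A ≤ P.localDepth :=
  idealDepth_le_idealDepth_localization P _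

theorem localDepth_le_height {A : Type*} [CommRing A] [IsNoetherianRing A] (P : Ideal A)
    [P.IsPrime] : P.localDepth ≤ P.height := by
  have : IsNoetherianRing (Localization.AtPrime P) :=
    IsLocalization.isNoetherianRing P.primeCompl _ inferInstance
  have h := idealDepth_maximalIdeal_le_ringKrullDim (Localization.AtPrime P)
  rw [IsLocalization.AtPrime.ringKrullDim_eq_height P] at h
  exact WithBot.coe_le_coe.mp h

theorem idealDepth_localizedModule_self {A : Type*} [CommRing A] (P : Ideal A) [P.IsPrime] :
    idealDepth (maximalIdeal (Localization.AtPrime P)) (LocalizedModule P.primeCompl A) =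
      P.localDepth :=
  LinearEquiv.idealDepth_eq ((IsLocalizedModule.linearEquiv P.primeCompl
    (LocalizedModule.mkLinearMap P.primeCompl A)
    (Algebra.linearMap A (Localization.AtPrime P))).extendScalarsOfIsLocalization
      P.primeCompl (Localization.AtPrime P)) _

/-- The maximal ideal of `A_Q` annihilates a nonzero element of `A_Q / J A_Q` if and only if `Q`
is the annihilator of an element of `A / J`. -/
theorem exists_smul_eq_zero_localization_iff {A : Type*} [CommRing A] [IsNoetherianRing A]
    (J Q : Ideal A) [Q.IsPrime] {K : Ideal (Localization.AtPrime Q)}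
    (hK : K = J.map (algebraMap A (Localization.AtPrime Q))) :
    (∃ m : Localization.AtPrime Q ⧸ (K • ⊤ : Submodule (Localization.AtPrime Q)
        (Localization.AtPrime Q)), m ≠ 0 ∧ ∀ r ∈ maximalIdeal (Localization.AtPrime Q), r • m = 0) ↔
      ∃ a : A, ∀ r, r * a ∈ J ↔ r ∈ Q := by
  have hKtop : (K • ⊤ : Submodule (Localization.AtPrime Q) (Localization.AtPrime Q)) = K := by
    rw [smul_eq_mul, Ideal.mul_top]
  rw [hKtop]
  have hmap (x : A) : algebraMap A (Localization.AtPrime Q) x ∈ K ↔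
      ∃ t ∈ Q.primeCompl, t * x ∈ J := by
    rw [hK, IsLocalization.algebraMap_mem_map_algebraMap_iff Q.primeCompl]
  have hmax (r : A) : algebraMap A (Localization.AtPrime Q) r ∈
      maximalIdeal (Localization.AtPrime Q) ↔ r ∈ Q :=
    IsLocalization.AtPrime.to_map_mem_maximal_iff _ Q r
  constructor
  · rintro ⟨m, hm, h⟩
    obtain ⟨s, rfl⟩ := Submodule.Quotient.mk_surjective _ m
    obtain ⟨a, t, rfl⟩ := IsLocalization.exists_mk'_eq Q.primeCompl s
    have hs : algebraMap A (Localization.AtPrime Q) a ∉ K := fun ha ↦ hm <| by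
      rw [Submodule.Quotient.mk_eq_zero, IsLocalization.mk'_eq_mul_mk'_one]
      exact K.mul_mem_right _ ha
    have hr (r : A) (hr : r ∈ Q) : algebraMap A (Localization.AtPrime Q) (r * a) ∈ K := by
      have := h _ ((hmax r).mpr hr)
      rw [← Submodule.Quotient.mk_smul, Submodule.Quotient.mk_eq_zero, smul_eq_mul] at this
      rw [map_mul, ← IsLocalization.mk'_spec _ a t, ← mul_assoc]
      exact K.mul_mem_right _ this
    -- Each generator `q` of `Q` needs its own `u q` outside `Q` to bring `q * a` into `J`; the
    -- product over the finite set `T` serves all generators at once. Off `Q` the value `1` is a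
    -- dummy.
    obtain ⟨T, hT⟩ := (isNoetherian_def.mp ‹IsNoetherianRing A›) Q
    have hex (q : A) : ∃ u ∈ Q.primeCompl, q ∈ Q → u * (q * a) ∈ J := by
      by_cases hq : q ∈ Q
      · obtain ⟨u, hu, hu'⟩ := (hmap _).mp (hr q hq)
        exact ⟨u, hu, fun _ ↦ hu'⟩
      · exact ⟨1, Q.primeCompl.one_mem, fun h ↦ absurd h hq⟩
    choose u hu hu' using hex
    refine ⟨(∏ q ∈ T, u q) * a, fun r ↦ ⟨fun hra ↦ ?_, fun hrQ ↦ ?_⟩⟩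
    · by_contra hrQ
      refine hs ((hmap a).mpr ⟨r * ∏ q ∈ T, u q, Q.primeCompl.mul_mem hrQ
        (Q.primeCompl.prod_mem fun q _ ↦ hu q), by rwa [mul_assoc]⟩)
    · have hle : Q ≤ J.colon {(∏ q ∈ T, u q) * a} := by
        rw [← hT]
        refine Ideal.span_le.mpr fun q hq ↦ ?_
        rw [SetLike.mem_coe, Submodule.mem_colon_singleton, smul_eq_mul]
        obtain ⟨c, hc⟩ := Finset.dvd_prod_of_mem u hq
        have : q * ((∏ q ∈ T, u q) * a) = c * (u q * (q * a)) := by rw [hc]; ring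
        rw [this]
        exact J.mul_mem_left _ (hu' q (hT ▸ Ideal.subset_span hq))
      simpa using Submodule.mem_colon_singleton.mp (hle hrQ)
  · rintro ⟨a, ha⟩
    refine ⟨Submodule.Quotient.mk (algebraMap A _ a), fun h0 ↦ ?_, fun s hs ↦ ?_⟩
    · rw [Submodule.Quotient.mk_eq_zero] at h0
      obtain ⟨t, ht, hta⟩ := (hmap a).mp h0
      exact ht ((ha t).mp hta)
    · obtain ⟨r, t, rfl⟩ := IsLocalization.exists_mk'_eq Q.primeCompl s
      have hrQ : r ∈ Q := (IsLocalization.AtPrime.mk'_mem_maximal_iff _ Q r t).mp hs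
      rw [← Submodule.Quotient.mk_smul, Submodule.Quotient.mk_eq_zero, smul_eq_mul,
        IsLocalization.mk'_eq_mul_mk'_one, mul_right_comm, ← map_mul]
      refine K.mul_mem_right _ ((hmap _).mpr ⟨1, Q.primeCompl.one_mem, ?_⟩)
      rw [one_mul]
      exact (ha r).mpr hrQ

theorem isWeaklyRegular_map_localization {A : Type*} [CommRing A] (Q : Ideal A) [Q.IsPrime]
    {rs : List A} (hreg : IsWeaklyRegular A rs) :
    IsWeaklyRegular (Localization.AtPrime Q)
      (rs.map (algebraMap A (Localization.AtPrime Q))) :=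
  hreg.of_isLocalization (Localization.AtPrime Q) Q.primeCompl

theorem forall_mem_maximalIdeal_map {A : Type*} [CommRing A] (Q : Ideal A) [Q.IsPrime]
    {rs : List A} (hmem : ∀ r ∈ rs, r ∈ Q) :
    ∀ s ∈ rs.map (algebraMap A (Localization.AtPrime Q)),
      s ∈ maximalIdeal (Localization.AtPrime Q) := by
  intro s hs
  obtain ⟨r, hr, rfl⟩ := List.mem_map.mp hs
  exact (IsLocalization.AtPrime.to_map_mem_maximal_iff _ Q r).mpr (hmem r hr)

/-- For a weakly regular sequence `rs` in a prime `Q`, the depth of `A_Q` is at most the length of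
`rs` if and only if `Q` is the annihilator of an element of `A / (rs)`. -/
theorem localDepth_le_length_iff {A : Type*} [CommRing A] [IsNoetherianRing A] (Q : Ideal A)
    [Q.IsPrime] {rs : List A} (hreg : IsWeaklyRegular A rs) (hmem : ∀ r ∈ rs, r ∈ Q) :
    Q.localDepth ≤ rs.length ↔ ∃ a : A, ∀ r, r * a ∈ Ideal.ofList rs ↔ r ∈ Q := by
  have : IsNoetherianRing (Localization.AtPrime Q) :=
    IsLocalization.isNoetherianRing Q.primeCompl _ inferInstance
  rw [← exists_smul_eq_zero_localization_iff (Ideal.ofList rs) Q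
    (Ideal.map_ofList _ rs).symm]
  constructor
  · intro h
    exact exists_smul_eq_zero_of_length_eq_idealDepth (maximalIdeal_smul_top_ne_top _)
      (forall_mem_maximalIdeal_map Q hmem) (isWeaklyRegular_map_localization Q hreg)
      (by rwa [List.length_map])
  · rintro ⟨m, hm, h⟩
    rw [Ideal.localDepth, idealDepth_eq_quotient_add_length (maximalIdeal_smul_top_ne_top _)
      (forall_mem_maximalIdeal_map Q hmem) (isWeaklyRegular_map_localization Q hreg),
      idealDepth_eq_zero_of_smul_eq_zero hm h, zero_add, List.length_map]

/-! ### The criterion `ht P ≤ depth A_P + 1` -/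

/-- For a maximal regular sequence `rs` in `P`, every prime `Q` with `rs ⊆ Q ≤ P` has local depth at
most that of `P`, so it is associated to `A/(rs)`. Prime avoidance gives `y ∈ P` outside all
associated primes not containing `P`. Then `P` is minimal over `(rs, y)`, and Krull's height theorem
applies. -/
theorem height_le_localDepth_add_one_of_idealDepth_eq {A : Type*} [CommRing A]
    [IsNoetherianRing A]
    (h : ∀ (P : Ideal A) [P.IsPrime], idealDepth P A = P.localDepth)
    (P : Ideal A) [hP : P.IsPrime] : P.height ≤ P.localDepth + 1 := by
  obtain ⟨d, hd⟩ := ENat.ne_top_iff_exists.mp <|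
    ((localDepth_le_height P).trans_lt (Ideal.height_lt_top hP.ne_top)).ne
  obtain ⟨rs, hlen, hmem, hreg⟩ := (natCast_le_idealDepth_iff hP.smul_top_ne_top).mp
    (hd.trans (h P).symm).le
  have hass (Q : Ideal A) [hQ : Q.IsPrime] (hrs : ∀ r ∈ rs, r ∈ Q) (hQP : Q ≤ P) :
      Q ∈ associatedPrimes A (A ⧸ Ideal.ofList rs) := by
    obtain ⟨a, ha⟩ := (localDepth_le_length_iff Q hreg.1 hrs).mp <| by
      rw [← h Q, hlen, hd, ← h P]
      exact idealDepth_mono hQP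
    rw [AssociatedPrimes.mem_iff, isAssociatedPrime_iff]
    refine ⟨hQ, Ideal.Quotient.mk _ a, Ideal.ext fun r ↦ ?_⟩
    rw [Submodule.mem_colon_singleton, Submodule.mem_bot, Algebra.smul_def,
      Ideal.Quotient.algebraMap_eq, ← map_mul, Ideal.Quotient.eq_zero_iff_mem, ha]
  obtain ⟨y, hyP, hy⟩ : ∃ y ∈ P,
      ∀ Q ∈ associatedPrimes A (A ⧸ Ideal.ofList rs), ¬ P ≤ Q → y ∉ Q := by
    by_contra! hc
    have hfin : {Q ∈ associatedPrimes A (A ⧸ Ideal.ofList rs) | ¬ P ≤ Q}.Finite :=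
      (associatedPrimes.finite A _).subset fun _ h ↦ h.1
    -- The two `⊥` fill the slots for possibly non-prime exceptions; every ideal in this family is
    -- prime.
    obtain ⟨Q, hQ, hPQ⟩ := (P.subset_union_prime_finite hfin (f := id) ⊥ ⊥
      fun Q hQ _ _ ↦ hQ.1.isPrime).mp fun y hy ↦ by
        obtain ⟨Q, hQ, hPQ, hyQ⟩ := hc y hy
        exact Set.mem_biUnion (show Q ∈ {Q ∈ _ | _} from ⟨hQ, hPQ⟩) hyQ
    exact hQ.2 hPQ
  have hmin : P ∈ (Ideal.span (insert y {r | r ∈ rs})).minimalPrimes := by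
    refine ⟨⟨hP, Ideal.span_le.mpr ?_⟩, fun Q ⟨hQ, hle⟩ hQP ↦ ?_⟩
    · rintro r (rfl | hr)
      exacts [hyP, hmem r hr]
    · by_contra hPQ
      have hsub := Ideal.span_le.mp hle
      exact hy Q (hass Q (fun r hr ↦ hsub (Or.inr hr)) hQP) hPQ (hsub (Or.inl rfl))
  classical
  have hset : insert y {r | r ∈ rs} = ((insert y rs.toFinset : Finset A) : Set A) := by
    ext; simp
  rw [hset] at hmin
  refine (Ideal.height_le_card_of_mem_minimalPrimes_span_finset hmin).trans ?_
  rw [← hd, ← hlen]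
  exact_mod_cast (Finset.card_insert_le _ _).trans
    (Nat.add_le_add_right (List.toFinset_card_le _) 1)

/-- A maximal regular sequence in `P`, of length `d`, puts `P` inside an associated prime `Q` of the
quotient, with `depth A_Q ≤ d`. If `P < Q`, then `ht P + 1 ≤ ht Q ≤ d + 1`, whence `depth A_P ≤ ht P
≤ d`. -/
theorem idealDepth_eq_localDepth_of_height_le {A : Type*} [CommRing A] [IsNoetherianRing A]
    (h : ∀ (P : Ideal A) [P.IsPrime], P.height ≤ P.localDepth + 1)
    (P : Ideal A) [hP : P.IsPrime] : idealDepth P A = P.localDepth := by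
  refine (idealDepth_le_localDepth P).antisymm ?_
  obtain ⟨d, hd⟩ := ENat.ne_top_iff_exists.mp <| ((idealDepth_le_localDepth P).trans_lt
    ((localDepth_le_height P).trans_lt (Ideal.height_lt_top hP.ne_top))).ne
  obtain ⟨rs, hlen, hmem, hreg⟩ := (natCast_le_idealDepth_iff hP.smul_top_ne_top).mp hd.le
  obtain ⟨m, hm, hPm⟩ := exists_smul_eq_zero_of_length_eq_idealDepth hP.smul_top_ne_top hmem
    hreg.1 (by rw [hlen, hd])
  obtain ⟨Q, hQ, hmQ⟩ := exists_le_isAssociatedPrime_of_isNoetherianRing A m hm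
  have hPQ : P ≤ Q := fun r hr ↦ hmQ <| by
    rw [Submodule.mem_colon_singleton, Submodule.mem_bot]; exact hPm r hr
  obtain ⟨hQ', n, hn⟩ := isAssociatedPrime_iff.mp hQ
  obtain ⟨a, rfl⟩ := Submodule.Quotient.mk_surjective _ n
  have hdQ : Q.localDepth ≤ d := by
    rw [← hlen, localDepth_le_length_iff Q hreg.1 fun r hr ↦ hPQ (hmem r hr)]
    refine ⟨a, fun r ↦ ?_⟩
    conv_rhs => rw [hn]
    rw [Submodule.mem_colon_singleton, Submodule.mem_bot, ← Submodule.Quotient.mk_smul,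
      Submodule.Quotient.mk_eq_zero, smul_eq_mul, smul_eq_mul, Ideal.mul_top]
  rw [← hd]
  rcases hPQ.eq_or_lt with rfl | hlt
  · exact hdQ
  · have h1 := (Ideal.height_add_one_le_of_lt_of_isPrime hlt).trans
      ((h Q).trans (add_le_add_left hdQ 1))
    exact (localDepth_le_height P).trans ((ENat.add_le_add_iff_right (by simp)).mp h1)

theorem isAlmostCohenMacaulayRing_iff_height_le {A : Type*} [CommRing A] [IsNoetherianRing A] :
    IsAlmostCohenMacaulayRing A ↔
      Nontrivial A ∧ ∀ (P : Ideal A) [P.IsPrime], P.height ≤ P.localDepth + 1 := by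
  constructor
  · intro h
    refine ⟨h.nontrivial, fun P hP ↦ height_le_localDepth_add_one_of_idealDepth_eq
      (fun Q hQ ↦ ?_) P⟩
    rw [← idealDepth_localizedModule_self Q]
    refine h.depth_eq ⟨Q, hQ⟩ ?_
    rw [Module.mem_support_iff_of_finite]
    exact fun x hx ↦ by
      rw [← mul_one x, ← smul_eq_mul, Module.mem_annihilator.mp hx 1]
      exact Q.zero_mem
  · rintro ⟨hA, h⟩
    refine ⟨hA, inferInstance, fun P _ ↦ ?_⟩
    rw [idealDepth_localizedModule_self]
    exact idealDepth_eq_localDepth_of_height_le h P.asIdeal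

/-! ### Depth when `p` lies directly below the maximal ideal -/

/-- If no prime lies strictly between `p` and the maximal ideal of a noetherian local ring, then
a finite module with a nonzero element annihilated by `p` has depth at most one. -/
theorem idealDepth_le_one_of_smul_eq_zero {R M : Type u} [CommRing R] [IsLocalRing R]
    [IsNoetherianRing R] [AddCommGroup M] [Module R M] [Module.Finite R M] {p : Ideal R}
    (hcov : ∀ q : Ideal R, q.IsPrime → p ≤ q → q = p ∨ q = maximalIdeal R)
    {m : M} (hm : m ≠ 0) (hpm : ∀ r ∈ p, r • m = 0) : idealDepth (maximalIdeal R) M ≤ 1 := by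
  by_cases h0 : idealDepth (maximalIdeal R) M = 0
  · simp [h0]
  obtain ⟨z, hz, hzreg⟩ := exists_isSMulRegular_of_idealDepth_ne_zero h0
  have hzp : z ∉ p := fun h ↦ hm (hzreg.right_eq_zero_of_smul (hpm z h))
  have hle : maximalIdeal R ≤ (⊥ : Ideal R).jacobson := maximalIdeal_le_jacobson _
  have : Nontrivial M := ⟨m, 0, hm⟩
  have htop : maximalIdeal R • (⊤ : Submodule R M) ≠ ⊤ := fun h ↦ top_ne_bot <|
    Submodule.eq_bot_of_le_smul_of_le_jacobson_bot _ _ Module.Finite.fg_top h.ge hle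
  -- Let `N` be the elements killed by `p`. If `N ⊆ zM`, regularity of `z` forces `N = zN`, so `N =
  -- 0` by Nakayama, contradicting `m ∈ N`.
  obtain ⟨s, hs, hsz⟩ : ∃ s ∈ Submodule.torsionBySet R M p, s ∉ (z • ⊤ : Submodule R M) := by
    by_contra! hc
    have hbot : Submodule.torsionBySet R M p = ⊥ := by
      refine Submodule.eq_bot_of_le_smul_of_le_jacobson_bot (Ideal.span {z}) _
        (IsNoetherian.noetherian _) (fun s hs ↦ ?_)
        (((Ideal.span_singleton_le_iff_mem _).mpr hz).trans hle)
      obtain ⟨n, -, rfl⟩ := (Submodule.mem_smul_pointwise_iff_exists _ _ _).mp (hc s hs)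
      rw [Submodule.ideal_span_singleton_smul]
      refine Submodule.smul_mem_pointwise_smul _ _ _ ?_
      rw [Submodule.mem_torsionBySet_iff] at hs ⊢
      exact fun r ↦ hzreg.right_eq_zero_of_smul (by rw [smul_comm]; exact hs r)
    refine hm ((Submodule.mem_bot R).mp (hbot ▸ ?_))
    rw [Submodule.mem_torsionBySet_iff]
    exact fun r ↦ hpm r r.2
  obtain ⟨q, hq, hsq⟩ := exists_le_isAssociatedPrime_of_isNoetherianRing R
    (Submodule.Quotient.mk s : QuotSMulTop z M)
    (by rwa [Ne, Submodule.Quotient.mk_eq_zero])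
  have hmk (r : R) (hr : r • s ∈ (z • ⊤ : Submodule R M)) : r ∈ q := hsq <| by
    rwa [Submodule.mem_colon_singleton, Submodule.mem_bot, ← Submodule.Quotient.mk_smul,
      Submodule.Quotient.mk_eq_zero]
  have hpq : p ≤ q := fun r hr ↦ hmk r <| by
    rw [(Submodule.mem_torsionBySet_iff _ _).mp hs ⟨r, hr⟩]
    exact Submodule.zero_mem _
  have hzq : z ∈ q := hmk z (Submodule.smul_mem_pointwise_smul _ _ _ trivial)
  -- `q` contains both `p` and `z ∉ p`, so it is maximal; being associated to `M/zM`, it makes that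
  -- quotient have depth zero.
  have hqmax : q = maximalIdeal R :=
    (hcov q hq.isPrime hpq).resolve_left fun h ↦ hzp (h ▸ hzq)
  obtain ⟨-, n, hn⟩ := isAssociatedPrime_iff.mp hq
  have hn0 : n ≠ 0 := by
    rintro rfl
    exact hq.isPrime.ne_top (by rw [hn]; ext; simp [Submodule.mem_colon_singleton])
  rw [idealDepth_eq_quotSMulTop_add_one htop hz hzreg,
    idealDepth_eq_zero_of_smul_eq_zero hn0, zero_add]
  intro r hr
  rw [← hqmax, hn] at hr
  simpa [Submodule.mem_colon_singleton] using hr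

/-- If no prime lies strictly between `p` and the maximal ideal of a noetherian local ring, then
its depth exceeds the depth with respect to `p` by at most one. -/
theorem idealDepth_maximalIdeal_le_add_one {R : Type u} [CommRing R] [IsLocalRing R]
    [IsNoetherianRing R] (p : Ideal R) [hp : p.IsPrime]
    (hcov : ∀ q : Ideal R, q.IsPrime → p ≤ q → q = p ∨ q = maximalIdeal R) :
    idealDepth (maximalIdeal R) R ≤ idealDepth p R + 1 := by
  obtain ⟨d, hd⟩ := ENat.ne_top_iff_exists.mp <| ((idealDepth_le_localDepth p).trans_lt
    ((localDepth_le_height p).trans_lt (Ideal.height_lt_top hp.ne_top))).ne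
  obtain ⟨rs, hlen, hmem, hreg⟩ := (natCast_le_idealDepth_iff hp.smul_top_ne_top).mp hd.le
  obtain ⟨n₀, hn₀, hpn₀⟩ := exists_smul_eq_zero_of_length_eq_idealDepth hp.smul_top_ne_top hmem
    hreg.1 (by rw [hlen, hd])
  have hmem' : ∀ r ∈ rs, r ∈ maximalIdeal R :=
    fun r hr ↦ le_maximalIdeal hp.ne_top (hmem r hr)
  -- Dividing by a maximal regular sequence in `p` leaves a module with a nonzero element killed by
  -- `p`, hence of depth at most one.
  rw [idealDepth_eq_quotient_add_length (maximalIdeal_smul_top_ne_top R) hmem' hreg.1, hlen, hd,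
    add_comm]
  exact add_le_add_right (idealDepth_le_one_of_smul_eq_zero hcov hn₀ hpn₀) _

/-! ### Height and depth modulo a regular element -/

theorem ringKrullDim_and_idealDepth_of_surjective {R : Type u} {S : Type*} [CommRing R]
    [CommRing S] [IsLocalRing R] [IsLocalRing S] [IsNoetherianRing R] {g : R →+* S}
    (hg : Function.Surjective g) {x : R} (hker : RingHom.ker g = Ideal.span {x})
    (hx : x ∈ maximalIdeal R) (hreg : IsSMulRegular R x) :
    ringKrullDim S + 1 = ringKrullDim R ∧
      idealDepth (maximalIdeal R) R = idealDepth (maximalIdeal S) S + 1 := by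
  have hspan : (x • ⊤ : Submodule R R) = Ideal.span {x} := by
    simp [← Submodule.ideal_span_singleton_smul]
  constructor
  · rw [← ringKrullDim_quotient_span_singleton_succ_eq_ringKrullDim hreg hx,
      ringKrullDim_eq_of_ringEquiv ((Ideal.quotEquivOfEq hker.symm).trans
        (RingHom.quotientKerEquivOfSurjective hg))]
  · rw [idealDepth_eq_quotSMulTop_add_one (maximalIdeal_smul_top_ne_top R) hx hreg]
    congr 1
    let e : QuotSMulTop x R ≃+ S :=
      ((Ideal.quotEquivOfEq (hspan.trans hker.symm)).trans
        (RingHom.quotientKerEquivOfSurjective hg)).toAddEquiv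
    have := IsLocalHom.of_surjective g hg
    refine idealDepth_eq_of_semilinear hg e (fun r m ↦ ?_) (maximalIdeal_comap g).symm
    obtain ⟨m, rfl⟩ := Submodule.Quotient.mk_surjective _ m
    exact map_mul g r m

/-- The induced map of local rings is again surjective with kernel generated by the image of `x`,
which stays regular, so the local statement applies. -/
theorem height_and_localDepth_comap_of_surjective {A B : Type u} [CommRing A] [CommRing B]
    [IsNoetherianRing A] {f : A →+* B} (hf : Function.Surjective f) {x : A}
    (hker : RingHom.ker f = Ideal.span {x}) (hreg : IsSMulRegular A x) (P : Ideal B)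
    [hP : P.IsPrime] :
    (P.comap f).height = P.height + 1 ∧ (P.comap f).localDepth = P.localDepth + 1 := by
  have : IsNoetherianRing (Localization.AtPrime (P.comap f)) :=
    IsLocalization.isNoetherianRing (P.comap f).primeCompl _ inferInstance
  have hxP : x ∈ P.comap f := by
    have : x ∈ RingHom.ker f := hker ▸ Ideal.mem_span_singleton_self x
    rw [Ideal.mem_comap, this]
    exact P.zero_mem
  have hg := RingHom.surjective_localRingHom_of_surjective f hf P
  have hkerg : RingHom.ker (Localization.localRingHom (P.comap f) P f rfl) =
      Ideal.span {algebraMap A (Localization.AtPrime (P.comap f)) x} := by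
    have hx0 : f x = 0 := by
      rw [← RingHom.mem_ker, hker]; exact Ideal.mem_span_singleton_self x
    refine le_antisymm (fun s hs ↦ ?_) ((Ideal.span_singleton_le_iff_mem _).mpr ?_)
    · obtain ⟨a, t, rfl⟩ := IsLocalization.exists_mk'_eq (P.comap f).primeCompl s
      rw [RingHom.mem_ker, Localization.localRingHom_mk', IsLocalization.mk'_eq_zero_iff] at hs
      obtain ⟨⟨u, hu⟩, hua⟩ := hs
      obtain ⟨v, rfl⟩ := hf u
      have hva : v * a ∈ Ideal.span {x} := by
        rw [← hker, RingHom.mem_ker, map_mul]; exact hua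
      rw [IsLocalization.mk'_eq_mul_mk'_one]
      refine Ideal.mul_mem_right _ _ ?_
      rw [← Set.image_singleton, ← Ideal.map_span,
        IsLocalization.algebraMap_mem_map_algebraMap_iff (P.comap f).primeCompl]
      exact ⟨v, hu, hva⟩
    · rw [RingHom.mem_ker, Localization.localRingHom_to_map, hx0, map_zero]
  have hx := (IsLocalization.AtPrime.to_map_mem_maximal_iff
    (Localization.AtPrime (P.comap f)) (P.comap f) x).mpr hxP
  have hreg' : IsSMulRegular (Localization.AtPrime (P.comap f))
      (algebraMap A (Localization.AtPrime (P.comap f)) x) := by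
    have := isWeaklyRegular_map_localization (P.comap f) (rs := [x])
      ((isWeaklyRegular_singleton_iff A x).mpr hreg)
    simpa using this
  obtain ⟨h1, h2⟩ := ringKrullDim_and_idealDepth_of_surjective hg hkerg hx hreg'
  refine ⟨?_, h2⟩
  rw [IsLocalization.AtPrime.ringKrullDim_eq_height P,
    IsLocalization.AtPrime.ringKrullDim_eq_height (P.comap f)] at h1
  exact_mod_cast h1.symm

/-! ### Local depth at primes minimal over `P + (x)` -/

theorem localDepth_eq_of_ringEquiv {A B : Type*} [CommRing A] [CommRing B] {P : Ideal A}
    [P.IsPrime] {Q : Ideal B} [Q.IsPrime]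
    (g : Localization.AtPrime P ≃+* Localization.AtPrime Q) : P.localDepth = Q.localDepth := by
  have := IsLocalHom.of_surjective g.toRingHom g.surjective
  exact idealDepth_eq_of_semilinear (f := g.toRingHom) g.surjective g.toAddEquiv
    (fun r m ↦ map_mul g r m) (maximalIdeal_comap g.toRingHom).symm

/-- No prime lies strictly between `P` and a prime minimal over `P + (x)`. -/
theorem eq_or_eq_of_mem_minimalPrimes_sup_span {A : Type*} [CommRing A] [IsNoetherianRing A]
    {P Q q : Ideal A} [P.IsPrime] [hq : q.IsPrime] {x : A}
    (hmin : Q ∈ (P ⊔ Ideal.span {x}).minimalPrimes) (hPq : P ≤ q) (hqQ : q ≤ Q) :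
    q = P ∨ q = Q := by
  rw [or_iff_not_imp_right]
  intro hne
  have hlt : q < Q := lt_of_le_of_ne hqQ hne
  have hQ : Q.IsPrime := hmin.1.1
  have hker (I : Ideal A) (hI : P ≤ I) : RingHom.ker (Ideal.Quotient.mk P) ≤ I := by
    rwa [Ideal.mk_ker]
  have hcomap (I : Ideal A) (hI : P ≤ I) :
      (I.map (Ideal.Quotient.mk P)).comap (Ideal.Quotient.mk P) = I := by
    rw [Ideal.comap_map_of_surjective' _ Ideal.Quotient.mk_surjective, sup_eq_left.mpr (hker I hI)]
  have := Ideal.map_isPrime_of_surjective Ideal.Quotient.mk_surjective (hker q hPq)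
  have := Ideal.map_isPrime_of_surjective Ideal.Quotient.mk_surjective (hker Q (hPq.trans hqQ))
  have hlt' : q.map (Ideal.Quotient.mk P) < Q.map (Ideal.Quotient.mk P) := by
    refine lt_of_le_of_ne (Ideal.map_mono hqQ) fun h ↦ hne ?_
    rw [← hcomap q hPq, h, hcomap Q (hPq.trans hqQ)]
  -- By Krull's principal ideal theorem `Q/P` has height at most one, so `q/P` has height zero in
  -- the domain `A/P` and is zero.
  have h1 := (Ideal.height_add_one_le_of_lt_of_isPrime hlt').trans
    (Ideal.map_height_le_one_of_mem_minimalPrimes hmin)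
  have h0 : (q.map (Ideal.Quotient.mk P)).height = 0 :=
    nonpos_iff_eq_zero.mp ((ENat.add_le_add_iff_right (by simp)).mp (h1.trans_eq (zero_add 1).symm))
  rw [Ideal.height_eq_zero_iff_eq_bot] at h0
  rw [← hcomap q hPq, h0]
  exact Ideal.mk_ker

/-- If `Q` is a prime minimal over `P + (x)`, then `depth A_Q ≤ depth A_P + 1`. -/
theorem localDepth_le_localDepth_add_one {A : Type u} [CommRing A] [IsNoetherianRing A]
    (P Q : Ideal A) [P.IsPrime] [hQ : Q.IsPrime] {x : A}
    (hmin : Q ∈ (P ⊔ Ideal.span {x}).minimalPrimes) : Q.localDepth ≤ P.localDepth + 1 := by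
  have hPQ : P ≤ Q := le_sup_left.trans hmin.1.2
  have hdisj : Disjoint (Q.primeCompl : Set A) P :=
    Set.disjoint_left.mpr fun a ha haP ↦ ha (hPQ haP)
  have : IsNoetherianRing (Localization.AtPrime Q) :=
    IsLocalization.isNoetherianRing Q.primeCompl _ inferInstance
  let p := P.map (algebraMap A (Localization.AtPrime Q))
  have hp : p.IsPrime := IsLocalization.isPrime_of_isPrime_disjoint Q.primeCompl _ P ‹_› hdisj
  have hpP : p.comap (algebraMap A (Localization.AtPrime Q)) = P :=
    IsLocalization.under_map_of_isPrime_disjoint Q.primeCompl _ ‹_› hdisj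
  -- Localizing `A_Q` at `P A_Q` gives `A_P`.
  have hdepth : p.localDepth = P.localDepth := by
    let g := (IsLocalization.localizationLocalizationAtPrimeIsoLocalization
      Q.primeCompl p).toRingEquiv
    have h : (p.comap (algebraMap A (Localization.AtPrime Q))).localDepth = p.localDepth :=
      localDepth_eq_of_ringEquiv g
    simpa only [hpP] using h.symm
  rw [← hdepth]
  refine (idealDepth_maximalIdeal_le_add_one p fun q hq hpq ↦ ?_).trans
    (add_le_add_left (idealDepth_le_localDepth p) 1)
  have hPq : P ≤ q.comap (algebraMap A (Localization.AtPrime Q)) := Ideal.map_le_iff_le_comap.mp hpq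
  have hqmap : (q.comap (algebraMap A (Localization.AtPrime Q))).map
      (algebraMap A (Localization.AtPrime Q)) = q := IsLocalization.map_under Q.primeCompl _ q
  have hqQ : q.comap (algebraMap A (Localization.AtPrime Q)) ≤ Q := fun r hr ↦
    (IsLocalization.AtPrime.to_map_mem_maximal_iff _ Q r).mp (le_maximalIdeal hq.ne_top hr)
  rcases eq_or_eq_of_mem_minimalPrimes_sup_span hmin hPq hqQ with h | h
  · exact Or.inl (by rw [← hqmap, h])
  · refine Or.inr ?_
    rw [← hqmap, h, Localization.AtPrime.map_eq_maximalIdeal]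

/-! ### Transfer along isomorphisms and quotients, and power series -/

theorem IsAlmostCohenMacaulayRing.of_ringEquiv {A B : Type*} [CommRing A] [CommRing B]
    [IsNoetherianRing A] (e : A ≃+* B) (h : IsAlmostCohenMacaulayRing A) :
    IsAlmostCohenMacaulayRing B := by
  have : IsNoetherianRing B := isNoetherianRing_of_ringEquiv A e
  rw [isAlmostCohenMacaulayRing_iff_height_le] at h ⊢
  obtain ⟨hA, h⟩ := h
  refine ⟨e.symm.toEquiv.nontrivial, fun P hP ↦ ?_⟩
  have h1 := h (P.comap e)
  rw [e.height_comap] at h1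
  let g := Localization.localRingEquiv (P.comap e) P e rfl
  have h2 : (P.comap e).localDepth = P.localDepth := localDepth_eq_of_ringEquiv g
  rwa [h2] at h1

/-- The almost Cohen-Macaulay property can be checked modulo a regular element in the Jacobson
radical. -/
theorem isAlmostCohenMacaulayRing_iff_of_surjective {A B : Type u} [CommRing A] [CommRing B]
    [IsNoetherianRing A] {f : A →+* B} (hf : Function.Surjective f) {x : A}
    (hker : RingHom.ker f = Ideal.span {x}) (hreg : IsSMulRegular A x)
    (hjac : x ∈ Ring.jacobson A) :
    IsAlmostCohenMacaulayRing A ↔ IsAlmostCohenMacaulayRing B := by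
  have : IsNoetherianRing B := isNoetherianRing_of_surjective A B f hf
  rw [isAlmostCohenMacaulayRing_iff_height_le, isAlmostCohenMacaulayRing_iff_height_le]
  have key (P : Ideal B) [P.IsPrime] : (P.comap f).height ≤ (P.comap f).localDepth + 1 ↔
      P.height ≤ P.localDepth + 1 := by
    obtain ⟨h1, h2⟩ := height_and_localDepth_comap_of_surjective hf hker hreg P
    rw [h1, h2, ENat.add_le_add_iff_right (by simp)]
  constructor
  · rintro ⟨hA, h⟩
    refine ⟨?_, fun P _ ↦ (key P).mp (h _)⟩
    by_contra hB
    rw [not_nontrivial_iff_subsingleton] at hB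
    obtain ⟨m, hm⟩ := Ideal.exists_maximal A
    have h1 : (1 : A) ∈ Ideal.span {x} := hker ▸ Subsingleton.elim _ _
    refine hm.ne_top (m.eq_top_iff_one.mpr ?_)
    refine Ideal.span_le.mpr ?_ h1
    rw [Set.singleton_subset_iff]
    exact Ring.jacobson_le_of_isMaximal m hjac
  · rintro ⟨hB, h⟩
    refine ⟨f.domain_nontrivial, fun P hP ↦ ?_⟩
    have hmem (Q : Ideal A) [Q.IsPrime] (hx : x ∈ Q) : Q.height ≤ Q.localDepth + 1 := by
      have hle : RingHom.ker f ≤ Q := by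
        rw [hker]; exact (Ideal.span_singleton_le_iff_mem Q).mpr hx
      have := Ideal.map_isPrime_of_surjective hf hle
      have hQ : Q = (Q.map f).comap f := by
        rw [Ideal.comap_map_of_surjective' f hf, sup_eq_left.mpr hle]
      have := (key (Q.map f)).mpr (h _)
      simpa only [← hQ] using this
    by_cases hx : x ∈ P
    · exact hmem P hx
    -- Since `x` lies in every maximal ideal, `P + (x)` is proper and has a minimal prime, where the
    -- inequality is already known.
    obtain ⟨m, hm, hPm⟩ := P.exists_le_maximal hP.ne_top
    have hle : P ⊔ Ideal.span {x} ≤ m :=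
      sup_le hPm ((Ideal.span_singleton_le_iff_mem m).mpr (Ring.jacobson_le_of_isMaximal m hjac))
    obtain ⟨Q, hQ, -⟩ := Ideal.exists_minimalPrimes_le hle
    have hQp := hQ.1.1
    have hxQ : x ∈ Q := hQ.1.2 (Ideal.mem_sup_right (Ideal.mem_span_singleton_self x))
    have hlt : P < Q := lt_of_le_of_ne (le_sup_left.trans hQ.1.2) fun h ↦ hx (h ▸ hxQ)
    have h1 := ((Ideal.height_add_one_le_of_lt_of_isPrime hlt).trans (hmem Q hxQ)).trans
      (add_le_add_left (localDepth_le_localDepth_add_one P Q hQ) 1)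
    exact (ENat.add_le_add_iff_right (by simp)).mp h1

theorem isAlmostCohenMacaulayRing_powerSeries_iff {A : Type*} [CommRing A] [IsNoetherianRing A] :
    IsAlmostCohenMacaulayRing (PowerSeries A) ↔ IsAlmostCohenMacaulayRing A := by
  refine isAlmostCohenMacaulayRing_iff_of_surjective (f := PowerSeries.constantCoeff)
    (x := PowerSeries.X) PowerSeries.constantCoeff_surj ?_ ?_ ?_
  · ext φ
    rw [RingHom.mem_ker, Ideal.mem_span_singleton, PowerSeries.X_dvd_iff]
  · intro φ ψ h
    exact PowerSeries.X_mul_cancel h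
  -- Every `X * φ + 1` has constant coefficient `1`, so it is a unit.
  · rw [← Ideal.jacobson_bot, Ideal.mem_jacobson_bot]
    intro φ
    rw [PowerSeries.isUnit_iff_constantCoeff]
    simp

theorem corollary2p4 (A : Type*) [CommRing A] [IsNoetherianRing A] (n : ℕ) :
    IsAlmostCohenMacaulayRing A ↔ IsAlmostCohenMacaulayRing (MvPowerSeries (Fin n) A) := by
  induction n with
  | zero =>
    let e : MvPowerSeries (Fin 0) A ≃+* A := (MvPowerSeries.isEmptyEquiv (Fin 0) A).toRingEquiv
    exact ⟨.of_ringEquiv e.symm, .of_ringEquiv e⟩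
  | succ n ih =>
    let e := (MvPowerSeries.finSuccEquiv A n).toRingEquiv
    rw [ih, ← isAlmostCohenMacaulayRing_powerSeries_iff]
    exact ⟨.of_ringEquiv e.symm, .of_ringEquiv e⟩
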